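/- Let $n\ge 2$ be an integer and let $a\in\mathbb R$ with $a+n\in(0,2)$. Put $s=\frac{2-a-n}{2}$; then $s\in(0,1)$. For an integer $d>n$ write points of $\mathbb R^d$ as $z=(x,y)\in\mathbb R^{d-n}\times\mathbb R^n$ and let $\Sigma_0=\{y=0\}$, identified with $\mathbb R^{d-n}$. For real-valued $\phi\in C_c^\infty(\mathbb R^d)$ and $u\in C_c^\infty(\mathbb R^{d-n})$ put $$\|\phi\|_{\mathcal D^{1,a}(\mathbb R^d)}^2=\int_{\mathbb R^d}|y|^a|\nabla\phi|^2\,dz,\qquad \|u\|_{\mathcal D^s(\mathbb R^{d-n})}^2=\int_{\mathbb R^{d-n}}|(-\Delta)^{s/2}u|^2\,dx,$$ where $(-\Delta)^{s/2}$ is the Fourier multiplier with symbol $|\xi|^{s}$ (for the Fourier transform with kernel $e^{-ix\cdot\xi}$). Let $\mathcal D^{1,a}(\mathbb R^d)$ and $\mathcal D^s(\mathbb R^{d-n})$ be the completions of $C_c^\infty(\mathbb R^d)$ and $C_c^\infty(\mathbb R^{d-n})$ with respect to these norms. Then there is a constant $C_{a,n}>0$, depending only on $a$ and $n$, such that for every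 integer $d>n$ $$C_{a,n}\,\|\phi|_{\Sigma_0}\|_{\mathcal D^s(\mathbb R^{d-n})}\le\|\phi\|_{\mathcal D^{1,a}(\mathbb R^d)}\qquad\text{for all }\phi\in C_c^\infty(\mathbb R^d).$$ Moreover, if $d+a>2$ (equivalently, $d-n>2s$), then the restriction $\phi\mapsto\phi|_{\Sigma_0}$, $\phi\in C_c^\infty(\mathbb R^d)$, extends uniquely to a continuous map $\mathrm{Tr}:\mathcal D^{1,a}(\mathbb R^d)\to\mathcal D^s(\mathbb R^{d-n})$; this map is linear and satisfies $C_{a,n}\|\mathrm{Tr}\,U\|_{\mathcal D^s(\mathbb R^{d-n})}\le\|U\|_{\mathcal D^{1,a}(\mathbb R^d)}$ for all $U\in\mathcal D^{1,a}(\mathbb R^d)$. -/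

import Mathlib

open MeasureTheory TopologicalSpace FourierTransform
open scoped Distributions ContDiff

noncomputable section

namespace WeightedTrace

/-- The Euclidean space `ℝᵏ`. -/
abbrev Rsp (k : ℕ) : Type := EuclideanSpace ℝ (Fin k)

/-- `C_c^∞(V)`: real-valued smooth functions with compact support on all of `V`. -/
abbrev Cc (V : Type) [NormedAddCommGroup V] [NormedSpace ℝ V] : Type :=
  𝓓((⊤ : Opens V), ℝ)

/-! ### Test functions on `ℝᵐ × ℝⁿ` and the weighted Dirichlet norm

The ambient space with coordinates `z = (x, y)` is `Rsp m × Rsp n`, with Lebesgue measure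
(the product of the Lebesgue measures). -/

/-- The Euclidean gradient `(∇ₓ φ, ∇_y φ)` of a function on `ℝᵐ × ℝⁿ`. It takes values in the
`ℓ²`-product, so that `‖grad φ z‖² = ‖∇ₓ φ (z)‖² + ‖∇_y φ (z)‖²`. -/
def grad {m n : ℕ} (φ : Rsp m × Rsp n → ℝ) (z : Rsp m × Rsp n) : WithLp 2 (Rsp m × Rsp n) :=
  WithLp.toLp 2 (gradient (fun x => φ (x, z.2)) z.1, gradient (fun y => φ (z.1, y)) z.2)

/-- The norm `(∫ |y|^a |∇φ|² dz)^{1/2}`. -/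
def dirichletNorm {m n : ℕ} (a : ℝ) (φ : Rsp m × Rsp n → ℝ) : ℝ :=
  √(∫ z, ‖z.2‖ ^ a * ‖grad φ z‖ ^ 2)

/-- The restriction `x ↦ φ (x, 0)` of a test function to `Σ₀ = {y = 0} = ℝᵐ`. -/
def restr {m n : ℕ} (φ : Cc (Rsp m × Rsp n)) : Cc (Rsp m) where
  toFun x := φ (x, 0)
  contDiff' := φ.contDiff.comp (contDiff_id.prodMk contDiff_const)
  hasCompactSupport' := by
    have h : Topology.IsClosedEmbedding (fun x : Rsp m => (x, (0 : Rsp n))) :=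
      ⟨isEmbedding_prodMkLeft 0, by
        have : Set.range (fun x : Rsp m => (x, (0 : Rsp n))) = Prod.snd ⁻¹' {0} := by
          ext ⟨x, y⟩; simp [eq_comm]
        rw [this]
        exact isClosed_singleton.preimage continuous_snd⟩
    exact φ.hasCompactSupport.comp_isClosedEmbedding h
  tsupport_subset' := fun _ _ => trivial

/-! ### The fractional Laplacian -/

/-- The fractional Laplacian `(-Δ)^σ u` on `ℝᵐ`, the Fourier multiplier with symbol `|ξ|^{2σ}`.
The Fourier transform `𝓕` uses the kernel `exp(-2πi x·ξ)`, so that the symbol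
reads `(2π|ξ|)^{2σ}` here. -/
def fracLaplacian {m : ℕ} (σ : ℝ) (u : Rsp m → ℝ) : Rsp m → ℂ :=
  𝓕⁻ (fun ξ : Rsp m => (((2 * Real.pi * ‖ξ‖) ^ (2 * σ) : ℝ) : ℂ) * 𝓕 (fun x => (u x : ℂ)) ξ)

/-- The norm `(∫ |(-Δ)^{s/2} u|² dx)^{1/2}`. -/
def fracNorm {m : ℕ} (s : ℝ) (u : Rsp m → ℝ) : ℝ :=
  √(∫ x, ‖fracLaplacian (s / 2) u x‖ ^ 2)

/-! ### Square-integrability facts, needed for the norms -/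

theorem sqrt_integral_eq {α F : Type*} [MeasurableSpace α] {μ : Measure α}
    [NormedAddCommGroup F] {f : α → F} (hf : MemLp f 2 μ) :
    √(∫ x, ‖f x‖ ^ 2 ∂μ) = (eLpNorm f 2 μ).toReal := by
  rw [hf.eLpNorm_eq_integral_rpow_norm (by norm_num) (by norm_num),
    ENNReal.toReal_ofReal (by positivity), Real.sqrt_eq_rpow]
  norm_num

theorem sqrt_integral_add_le {α F : Type*} [MeasurableSpace α] {μ : Measure α}
    [NormedAddCommGroup F] {f g : α → F} (hf : MemLp f 2 μ) (hg : MemLp g 2 μ) :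
    √(∫ x, ‖f x + g x‖ ^ 2 ∂μ) ≤ √(∫ x, ‖f x‖ ^ 2 ∂μ) + √(∫ x, ‖g x‖ ^ 2 ∂μ) := by
  rw [sqrt_integral_eq hf, sqrt_integral_eq hg]
  have h := sqrt_integral_eq (hf.add hg)
  simp only [Pi.add_apply] at h
  rw [h, ← ENNReal.toReal_add hf.eLpNorm_ne_top hg.eLpNorm_ne_top]
  exact ENNReal.toReal_mono (ENNReal.add_ne_top.2 ⟨hf.eLpNorm_ne_top, hg.eLpNorm_ne_top⟩)
    (eLpNorm_add_le hf.1 hg.1 (by norm_num))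

theorem differentiable_left {m n : ℕ} (φ : Cc (Rsp m × Rsp n)) (z : Rsp m × Rsp n) :
    DifferentiableAt ℝ (fun x => φ (x, z.2)) z.1 :=
  ((φ.contDiff.differentiable (by simp)).comp
    (differentiable_id.prodMk (differentiable_const _))) z.1

theorem differentiable_right {m n : ℕ} (φ : Cc (Rsp m × Rsp n)) (z : Rsp m × Rsp n) :
    DifferentiableAt ℝ (fun y => φ (z.1, y)) z.2 :=
  ((φ.contDiff.differentiable (by simp)).comp
    ((differentiable_const _).prodMk differentiable_id)) z.2

theorem grad_add {m n : ℕ} (φ ψ : Cc (Rsp m × Rsp n)) (z : Rsp m × Rsp n) :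
    grad (φ + ψ : Cc _) z = grad φ z + grad ψ z := by
  have h₁ := fderiv_add (differentiable_left φ z) (differentiable_left ψ z)
  have h₂ := fderiv_add (differentiable_right φ z) (differentiable_right ψ z)
  have e₁ : (fun x => (φ + ψ : Cc _) (x, z.2)) =
    (fun x => φ (x, z.2)) + fun x => ψ (x, z.2) := rfl
  have e₂ : (fun y => (φ + ψ : Cc _) (z.1, y)) =
    (fun y => φ (z.1, y)) + fun y => ψ (z.1, y) := rfl
  simp only [grad, gradient, e₁, e₂, h₁, h₂, map_add]
  rfl

theorem grad_smul {m n : ℕ} (c : ℝ) (φ : Cc (Rsp m × Rsp n)) (z : Rsp m × Rsp n) :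
    grad (c • φ : Cc _) z = c • grad φ z := by
  have h₁ := fderiv_const_smul (differentiable_left φ z) c
  have h₂ := fderiv_const_smul (differentiable_right φ z) c
  have e₁ : (fun x => (c • φ : Cc _) (x, z.2)) = c • fun x => φ (x, z.2) := rfl
  have e₂ : (fun y => (c • φ : Cc _) (z.1, y)) = c • fun y => φ (z.1, y) := rfl
  simp only [grad, gradient, e₁, e₂, h₁, h₂, map_smul]
  rfl

theorem grad_eq {m n : ℕ} (φ : Cc (Rsp m × Rsp n)) (z : Rsp m × Rsp n) :
    grad φ z = WithLp.toLp 2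
      ((InnerProductSpace.toDual ℝ (Rsp m)).symm
        ((fderiv ℝ φ z).comp (ContinuousLinearMap.inl ℝ (Rsp m) (Rsp n))),
       (InnerProductSpace.toDual ℝ (Rsp n)).symm
        ((fderiv ℝ φ z).comp (ContinuousLinearMap.inr ℝ (Rsp m) (Rsp n)))) := by
  have hd : DifferentiableAt ℝ φ z := φ.contDiff.differentiable (by simp) z
  have h₁ : fderiv ℝ (fun x => φ (x, z.2)) z.1 =
      (fderiv ℝ φ z).comp (ContinuousLinearMap.inl ℝ (Rsp m) (Rsp n)) :=
    (HasFDerivAt.comp z.1 (g := φ) (f := fun x => (x, z.2)) hd.hasFDerivAt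
      (hasFDerivAt_prodMk_left z.1 z.2)).fderiv
  have h₂ : fderiv ℝ (fun y => φ (z.1, y)) z.2 =
      (fderiv ℝ φ z).comp (ContinuousLinearMap.inr ℝ (Rsp m) (Rsp n)) :=
    (HasFDerivAt.comp z.2 (g := φ) (f := fun y => (z.1, y)) hd.hasFDerivAt
      (hasFDerivAt_prodMk_right z.1 z.2)).fderiv
  simp only [grad, gradient, h₁, h₂]

theorem continuous_grad {m n : ℕ} (φ : Cc (Rsp m × Rsp n)) : Continuous (grad φ) := by
  rw [show grad φ = _ from funext (grad_eq φ)]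
  have hc : Continuous (fderiv ℝ φ) := φ.contDiff.continuous_fderiv (by simp)
  refine (WithLp.prod_continuous_toLp 2 _ _).comp (Continuous.prodMk ?_ ?_)
  · exact (LinearIsometryEquiv.continuous _).comp (hc.clm_comp continuous_const)
  · exact (LinearIsometryEquiv.continuous _).comp (hc.clm_comp continuous_const)

theorem hasCompactSupport_grad {m n : ℕ} (φ : Cc (Rsp m × Rsp n)) :
    HasCompactSupport (grad φ) := by
  refine (φ.hasCompactSupport.fderiv ℝ).mono fun z hz hz' => hz ?_
  rw [grad_eq, hz']
  simp

/-- The weight `|y|^a` is locally integrable when `a + n > 0`. -/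
theorem locallyIntegrable_weight {n : ℕ} {a : ℝ} (ha : 0 < a + n) :
    LocallyIntegrable (fun y : Rsp n => ‖y‖ ^ a) := by
  have hm : AEStronglyMeasurable (fun y : Rsp n => ‖y‖ ^ a) volume :=
    (measurable_norm.pow_const a).aestronglyMeasurable
  rcases Nat.eq_zero_or_pos n with rfl | hn
  · have : (fun y : Rsp 0 => ‖y‖ ^ a) = fun _ => (0 : ℝ) ^ a := by
      ext y; rw [Subsingleton.elim y 0, norm_zero]
    rw [this]
    exact locallyIntegrable_const _
  · refine locallyIntegrable_of_norm_le_rpow (C := 1) (α := -a) (by simpa using Nat.succ_le_of_lt hn)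
      (by simp; linarith) (Filter.Eventually.of_forall fun y => ?_) hm
    simp [abs_of_nonneg (Real.rpow_nonneg (norm_nonneg y) a)]

/-- `|y|^{a/2} ∇φ` is square-integrable when `a + n > 0`. -/
theorem memLp_weighted_grad {m n : ℕ} {a : ℝ} (ha : 0 < a + n) (φ : Cc (Rsp m × Rsp n)) :
    MemLp (fun z : Rsp m × Rsp n => ‖z.2‖ ^ (a / 2) • grad φ z) 2 := by
  have hmeas : AEStronglyMeasurable
      (fun z : Rsp m × Rsp n => ‖z.2‖ ^ (a / 2) • grad φ z) volume :=
    ((measurable_snd.norm.pow_const (a / 2)).aestronglyMeasurable).smul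
      (continuous_grad φ).aestronglyMeasurable
  rw [memLp_two_iff_integrable_sq_norm hmeas]
  have hsq : (fun z : Rsp m × Rsp n => ‖‖z.2‖ ^ (a / 2) • grad φ z‖ ^ 2) =
      fun z => ‖z.2‖ ^ a * ‖grad φ z‖ ^ 2 := by
    ext z
    rw [norm_smul, mul_pow, Real.norm_of_nonneg (by positivity), ← Real.rpow_mul_natCast
      (norm_nonneg _)]
    norm_num
  rw [hsq]
  obtain ⟨C, hC⟩ := (continuous_grad φ).bounded_above_of_compact_support (hasCompactSupport_grad φ)
  set K : Set (Rsp m × Rsp n) := tsupport (grad φ) with hK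
  have hKc : IsCompact K := hasCompactSupport_grad φ
  have h1 : IntegrableOn (fun y : Rsp n => ‖y‖ ^ a) (Prod.snd '' K) :=
    (locallyIntegrable_weight ha).integrableOn_isCompact (hKc.image continuous_snd)
  have h2 : IntegrableOn (fun _ : Rsp m => C ^ 2) (Prod.fst '' K) :=
    continuousOn_const.integrableOn_compact (hKc.image continuous_fst)
  have h3 : IntegrableOn (fun z : Rsp m × Rsp n => C ^ 2 * ‖z.2‖ ^ a) K := by
    have := Integrable.mul_prod h2 h1
    rw [Measure.prod_restrict] at this
    exact IntegrableOn.mono_set (μ := volume) this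
      fun z hz => ⟨⟨z, hz, rfl⟩, ⟨z, hz, rfl⟩⟩
  have hz : ∀ z, z ∉ K → ‖z.2‖ ^ a * ‖grad φ z‖ ^ 2 = 0 := fun z hz => by
    rw [image_eq_zero_of_notMem_tsupport hz]; simp
  rw [← integrableOn_iff_integrable_of_support_subset (s := K)
    (fun z hz' => by by_contra h; exact hz' (hz z h))]
  refine Integrable.mono' h3 ?_ (Filter.Eventually.of_forall fun z => ?_)
  · rw [← hsq]; exact (hmeas.norm.pow 2).restrict
  · rw [Real.norm_of_nonneg (by positivity), mul_comm]
    gcongr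
    exact hC z

theorem dirichletNorm_eq {m n : ℕ} (a : ℝ) (φ : Rsp m × Rsp n → ℝ) :
    dirichletNorm a φ = √(∫ z : Rsp m × Rsp n, ‖‖z.2‖ ^ (a / 2) • grad φ z‖ ^ 2) := by
  unfold dirichletNorm
  congr 2
  ext z
  rw [norm_smul, mul_pow, Real.norm_of_nonneg (by positivity), ← Real.rpow_mul_natCast
    (norm_nonneg _)]
  norm_num

/-- `dirichletNorm` as a seminorm on test functions. -/
def dirichletSeminorm (m n : ℕ) (a : ℝ) (ha : 0 < a + n) : Seminorm ℝ (Cc (Rsp m × Rsp n)) :=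
  Seminorm.of (fun φ => dirichletNorm a φ)
    (fun φ ψ => by
      simp only [dirichletNorm_eq, grad_add, smul_add]
      exact sqrt_integral_add_le (memLp_weighted_grad ha φ) (memLp_weighted_grad ha ψ))
    (fun c φ => by
      simp only [dirichletNorm, grad_smul, norm_smul, mul_pow]
      simp_rw [mul_left_comm _ (‖c‖ ^ 2)]
      rw [integral_const_mul, Real.sqrt_mul (by positivity), Real.sqrt_sq (norm_nonneg c)])

/-- The function `(2π|ξ|)^{2σ} û(ξ)`. -/
def fracSymbolMul {m : ℕ} (σ : ℝ) (u : Rsp m → ℝ) (ξ : Rsp m) : ℂ :=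
  (((2 * Real.pi * ‖ξ‖) ^ (2 * σ) : ℝ) : ℂ) * 𝓕 (fun x => (u x : ℂ)) ξ

/-- A test function as a complex-valued Schwartz function. -/
def toSchwartz {m : ℕ} (u : Cc (Rsp m)) : SchwartzMap (Rsp m) ℂ :=
  HasCompactSupport.toSchwartzMap (f := fun x => (u x : ℂ))
    (u.hasCompactSupport.comp_left (g := fun t : ℝ => (t : ℂ)) (by simp))
    (Complex.ofRealCLM.contDiff.comp u.contDiff)

theorem fourier_eq {m : ℕ} (u : Cc (Rsp m)) :
    𝓕 (fun x => (u x : ℂ)) = 𝓕 (toSchwartz u) := by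
  rw [SchwartzMap.fourier_coe]
  rfl

theorem fracSymbolMul_bound {m : ℕ} {σ : ℝ} (hσ : 0 ≤ σ) (u : Cc (Rsp m)) :
    ∃ k : ℕ, ∃ C : ℝ, ∀ ξ, ‖fracSymbolMul σ u ξ‖ ≤
      C * (‖𝓕 (toSchwartz u) ξ‖ + ‖ξ‖ ^ k * ‖𝓕 (toSchwartz u) ξ‖) := by
  refine ⟨⌈2 * σ⌉₊, (2 * Real.pi) ^ (2 * σ), fun ξ => ?_⟩
  have h : ‖ξ‖ ^ (2 * σ) ≤ 1 + ‖ξ‖ ^ ⌈2 * σ⌉₊ := by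
    rcases le_total ‖ξ‖ 1 with h | h
    · have := Real.rpow_le_one (norm_nonneg ξ) h (by positivity : 0 ≤ 2 * σ)
      have : 0 ≤ ‖ξ‖ ^ ⌈2 * σ⌉₊ := by positivity
      linarith
    · have := Real.rpow_le_rpow_of_exponent_le h (Nat.le_ceil (2 * σ))
      rw [Real.rpow_natCast] at this
      linarith
  rw [fracSymbolMul, norm_mul, Complex.norm_real, Real.norm_of_nonneg (by positivity),
    Real.mul_rpow (by positivity) (norm_nonneg ξ), fourier_eq, mul_assoc]
  have := mul_le_mul_of_nonneg_right h (norm_nonneg (𝓕 (toSchwartz u) ξ))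
  rw [add_mul, one_mul] at this
  exact mul_le_mul_of_nonneg_left this (by positivity)

theorem continuous_fracSymbolMul {m : ℕ} {σ : ℝ} (hσ : 0 ≤ σ) (u : Cc (Rsp m)) :
    Continuous (fracSymbolMul σ u) := by
  unfold fracSymbolMul
  rw [fourier_eq]
  refine Continuous.mul (Complex.continuous_ofReal.comp ?_) (𝓕 (toSchwartz u)).continuous
  exact (continuous_const.mul continuous_norm).rpow_const fun _ => Or.inr (by positivity)

theorem integrable_fracSymbolMul {m : ℕ} {σ : ℝ} (hσ : 0 ≤ σ) (u : Cc (Rsp m)) :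
    Integrable (fracSymbolMul σ u) := by
  obtain ⟨k, C, h⟩ := fracSymbolMul_bound hσ u
  exact Integrable.mono' (((𝓕 (toSchwartz u)).integrable.norm.add
    ((𝓕 (toSchwartz u)).integrable_pow_mul volume k)).const_mul C)
    (continuous_fracSymbolMul hσ u).aestronglyMeasurable (Filter.Eventually.of_forall h)

theorem memLp_fracSymbolMul {m : ℕ} {σ : ℝ} (hσ : 0 ≤ σ) (u : Cc (Rsp m)) :
    MemLp (fracSymbolMul σ u) 2 := by
  obtain ⟨k, C, h⟩ := fracSymbolMul_bound hσ u
  obtain ⟨B₀, -, h₀⟩ := (𝓕 (toSchwartz u)).decay 0 0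
  obtain ⟨B₁, -, h₁⟩ := (𝓕 (toSchwartz u)).decay k 0
  have hb : ∀ ξ, ‖fracSymbolMul σ u ξ‖ ≤ |C| * (B₀ + B₁) := fun ξ => by
    have e₀ := h₀ ξ
    have e₁ := h₁ ξ
    simp only [norm_iteratedFDeriv_zero, pow_zero, one_mul] at e₀ e₁
    exact (h ξ).trans ((mul_le_mul_of_nonneg_right (le_abs_self C) (by positivity)).trans
      (mul_le_mul_of_nonneg_left (add_le_add e₀ e₁) (abs_nonneg C)))
  have hm := (continuous_fracSymbolMul hσ u).aestronglyMeasurable (μ := volume)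
  rw [memLp_two_iff_integrable_sq_norm hm]
  refine Integrable.mono' ((integrable_fracSymbolMul hσ u).norm.const_mul (|C| * (B₀ + B₁)))
    (hm.norm.pow 2) (Filter.Eventually.of_forall fun ξ => ?_)
  rw [Real.norm_of_nonneg (by positivity), sq]
  exact mul_le_mul_of_nonneg_right (hb ξ) (norm_nonneg _)

/-- The inverse Fourier integral of a function in `L¹ ∩ L²` is its inverse `L²` Fourier
transform. -/
theorem fourierInv_toLp_ae_eq {m : ℕ} {g : Rsp m → ℂ} (h1 : Integrable g) (h2 : MemLp g 2) :
    (𝓕⁻ (h2.toLp g) : Lp ℂ 2 (volume : Measure (Rsp m))) =ᵐ[volume] 𝓕⁻ g := by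
  have hcont : Continuous (𝓕⁻ g) := by
    have : 𝓕⁻ g = fun x => 𝓕 g (-x) := by
      ext x; exact Real.fourierInv_eq_fourier_neg g x
    rw [this]
    exact (VectorFourier.fourierIntegral_continuous Real.continuous_fourierChar
      (by exact continuous_inner) h1).comp continuous_neg
  refine ae_eq_of_integral_contDiff_smul_eq
    (MemLp.locallyIntegrable (Lp.memLp (𝓕⁻ (h2.toLp g) : Lp ℂ 2 (volume : Measure (Rsp m)))) (by norm_num)) hcont.locallyIntegrable fun φ hφ hφc => ?_
  have c₁ : HasCompactSupport (Complex.ofRealCLM ∘ φ) := hφc.comp_left rfl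
  have c₂ : ContDiff ℝ ∞ (Complex.ofRealCLM ∘ φ) := Complex.ofRealCLM.contDiff.comp hφ
  set Φ := c₁.toSchwartzMap c₂ with hΦ
  have hΦv : ∀ x, Φ x = (φ x : ℂ) := fun x => rfl
  have key := congrArg (fun T : TemperedDistribution (Rsp m) ℂ => T Φ)
    (Lp.fourierInv_toTemperedDistribution_eq (h2.toLp g))
  simp only [TemperedDistribution.fourierInv_apply, Lp.toTemperedDistribution_apply] at key
  have e₁ : ∫ x, φ x • (𝓕⁻ (h2.toLp g) : Lp ℂ 2 (volume : Measure (Rsp m))) x =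
      ∫ x, Φ x • (𝓕⁻ (h2.toLp g) : Lp ℂ 2 (volume : Measure (Rsp m))) x := by
    simp [hΦv]
  have e₂ : ∫ x, (𝓕⁻ Φ) x • (h2.toLp g) x = ∫ x, (𝓕⁻ Φ) x • g x := by
    refine integral_congr_ae ?_
    filter_upwards [h2.coeFn_toLp] with x hx
    rw [hx]
  have e₃ : ∫ x, φ x • 𝓕⁻ g x = ∫ x, Φ x • 𝓕⁻ g x := by
    simp [hΦv]
  rw [e₁, e₃, ← key, e₂]
  have he : ((𝓕⁻ Φ : SchwartzMap (Rsp m) ℂ) : Rsp m → ℂ) = 𝓕⁻ (Φ : Rsp m → ℂ) := SchwartzMap.fourierInv_coe Φ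
  rw [he]
  have h := VectorFourier.integral_fourierIntegral_smul_eq_flip (L := -innerₗ (Rsp m))
    Real.continuous_fourierChar (continuous_inner (𝕜 := ℝ) (E := Rsp m)).neg
    (Φ.integrable (μ := volume)) h1
  have hL : (-innerₗ (Rsp m)).flip = -innerₗ (Rsp m) := by
    ext v w
    simpa using real_inner_comm v w
  rw [hL] at h
  exact h

/-- `(-Δ)^σ u` is square-integrable for a test function `u` and `σ ≥ 0`. -/
theorem memLp_fracLaplacian {m : ℕ} {σ : ℝ} (hσ : 0 ≤ σ) (u : Cc (Rsp m)) :
    MemLp (fracLaplacian σ u) 2 :=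
  (memLp_congr_ae (fourierInv_toLp_ae_eq (integrable_fracSymbolMul hσ u)
    (memLp_fracSymbolMul hσ u))).1 (Lp.memLp _)

theorem fracLaplacian_add {m : ℕ} {σ : ℝ} (hσ : 0 ≤ σ) (u v : Cc (Rsp m)) (x : Rsp m) :
    fracLaplacian σ (u + v : Cc _) x = fracLaplacian σ u x + fracLaplacian σ v x := by
  have hs : fracSymbolMul σ (u + v : Cc _) = fracSymbolMul σ u + fracSymbolMul σ v := by
    ext ξ
    have h : toSchwartz (u + v) = toSchwartz u + toSchwartz v := by
      ext x; exact Complex.ofReal_add _ _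
    simp only [fracSymbolMul, Pi.add_apply]
    rw [fourier_eq, fourier_eq, fourier_eq, h, FourierTransform.fourier_add, ← mul_add]
    rfl
  have h := VectorFourier.fourierIntegral_add (L := -innerₗ (Rsp m)) Real.continuous_fourierChar
    (continuous_inner (𝕜 := ℝ) (E := Rsp m)).neg
    (integrable_fracSymbolMul hσ u) (integrable_fracSymbolMul hσ v)
  change (𝓕⁻ (fracSymbolMul σ (u + v : Cc _)) : Rsp m → ℂ) x = _
  rw [hs]
  exact congrFun h x

theorem fracLaplacian_smul {m : ℕ} {σ : ℝ} (c : ℝ) (u : Cc (Rsp m)) (x : Rsp m) :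
    fracLaplacian σ (c • u : Cc _) x = (c : ℂ) * fracLaplacian σ u x := by
  have hs : fracSymbolMul σ (c • u : Cc _) = (c : ℂ) • fracSymbolMul σ u := by
    ext ξ
    have h : toSchwartz (c • u) = (c : ℂ) • toSchwartz u := by
      ext x; exact Complex.ofReal_mul _ _
    simp only [fracSymbolMul, Pi.smul_apply]
    rw [fourier_eq, fourier_eq, h, FourierTransform.fourier_smul, smul_eq_mul, mul_left_comm]
    rfl
  have h := VectorFourier.fourierIntegral_const_smul Real.fourierChar volume
    (-innerₗ (Rsp m)) (fracSymbolMul σ u) (c : ℂ)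
  change (𝓕⁻ (fracSymbolMul σ (c • u : Cc _)) : Rsp m → ℂ) x = _
  rw [hs]
  exact congrFun h x

/-- `fracNorm` as a seminorm on test functions. -/
def fracSeminorm (m : ℕ) (s : ℝ) (hs : 0 < s) : Seminorm ℝ (Cc (Rsp m)) :=
  Seminorm.of (fun u => fracNorm s u)
    (fun u v => by
      have hs' : 0 ≤ s / 2 := by positivity
      simp only [fracNorm, fracLaplacian_add hs']
      exact sqrt_integral_add_le (memLp_fracLaplacian hs' u) (memLp_fracLaplacian hs' v))
    (fun c u => by
      simp only [fracNorm, fracLaplacian_smul, norm_mul, mul_pow, Complex.norm_real]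
      rw [integral_const_mul, Real.sqrt_mul (by positivity), Real.sqrt_sq (norm_nonneg c)])

/-! ### The energy spaces, as completions of the test functions -/

/-- `C_c^∞(ℝᵐ × ℝⁿ)`, equipped with `dirichletNorm a` in place of its usual topology. -/
def PreD1 (m n : ℕ) (a : ℝ) (_ha : 0 < a + n) : Type := Cc (Rsp m × Rsp n)

instance (m n : ℕ) (a : ℝ) (ha : 0 < a + n) : AddCommGroup (PreD1 m n a ha) :=
  inferInstanceAs (AddCommGroup (Cc (Rsp m × Rsp n)))

instance (m n : ℕ) (a : ℝ) (ha : 0 < a + n) : Module ℝ (PreD1 m n a ha) :=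
  inferInstanceAs (Module ℝ (Cc (Rsp m × Rsp n)))

instance (m n : ℕ) (a : ℝ) (ha : 0 < a + n) : SeminormedAddCommGroup (PreD1 m n a ha) :=
  AddGroupSeminorm.toSeminormedAddCommGroup (E := PreD1 m n a ha)
    (dirichletSeminorm m n a ha).toAddGroupSeminorm

instance (m n : ℕ) (a : ℝ) (ha : 0 < a + n) : NormedSpace ℝ (PreD1 m n a ha) where
  norm_smul_le c φ := (map_smul_eq_mul (dirichletSeminorm m n a ha) c φ).le

/-- The space `𝒟^{1,a}(ℝᵐ × ℝⁿ)`, the (Hausdorff) completion of `C_c^∞` in the norm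
`dirichletNorm a`. -/
abbrev D1 (m n : ℕ) (a : ℝ) (ha : 0 < a + n) : Type :=
  UniformSpace.Completion (PreD1 m n a ha)

/-- The canonical map `C_c^∞(ℝᵐ × ℝⁿ) → 𝒟^{1,a}(ℝᵐ × ℝⁿ)`. -/
def toD1 {m n : ℕ} {a : ℝ} (ha : 0 < a + n) (φ : Cc (Rsp m × Rsp n)) : D1 m n a ha :=
  ((show PreD1 m n a ha from φ : PreD1 m n a ha) : UniformSpace.Completion (PreD1 m n a ha))

/-- `C_c^∞(ℝᵐ)`, equipped with `fracNorm s` in place of its usual topology. -/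
def PreDs (m : ℕ) (s : ℝ) (_hs : 0 < s) : Type := Cc (Rsp m)

instance (m : ℕ) (s : ℝ) (hs : 0 < s) : AddCommGroup (PreDs m s hs) :=
  inferInstanceAs (AddCommGroup (Cc (Rsp m)))

instance (m : ℕ) (s : ℝ) (hs : 0 < s) : Module ℝ (PreDs m s hs) :=
  inferInstanceAs (Module ℝ (Cc (Rsp m)))

instance (m : ℕ) (s : ℝ) (hs : 0 < s) : SeminormedAddCommGroup (PreDs m s hs) :=
  AddGroupSeminorm.toSeminormedAddCommGroup (E := PreDs m s hs)
    (fracSeminorm m s hs).toAddGroupSeminorm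

instance (m : ℕ) (s : ℝ) (hs : 0 < s) : NormedSpace ℝ (PreDs m s hs) where
  norm_smul_le c u := (map_smul_eq_mul (fracSeminorm m s hs) c u).le

/-- The space `𝒟ˢ(ℝᵐ)`, the (Hausdorff) completion of `C_c^∞(ℝᵐ)` in the norm `fracNorm s`. -/
abbrev Ds (m : ℕ) (s : ℝ) (hs : 0 < s) : Type :=
  UniformSpace.Completion (PreDs m s hs)

/-- The canonical map `C_c^∞(ℝᵐ) → 𝒟ˢ(ℝᵐ)`. -/
def toDs {m : ℕ} {s : ℝ} (hs : 0 < s) (u : Cc (Rsp m)) : Ds m s hs :=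
  ((show PreDs m s hs from u : PreDs m s hs) : UniformSpace.Completion (PreDs m s hs))

/-- The canonical map is isometric. -/
theorem norm_toD1 {m n : ℕ} {a : ℝ} (ha : 0 < a + n) (φ : Cc (Rsp m × Rsp n)) :
    ‖toD1 ha φ‖ = dirichletNorm a φ :=
  UniformSpace.Completion.norm_coe (E := PreD1 m n a ha) φ

/-- The canonical map is isometric. -/
theorem norm_toDs {m : ℕ} {s : ℝ} (hs : 0 < s) (u : Cc (Rsp m)) :
    ‖toDs hs u‖ = fracNorm s u :=
  UniformSpace.Completion.norm_coe (E := PreDs m s hs) u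

end WeightedTrace

end

open WeightedTrace

/-!
The inequality is reduced to one real variable. In polar coordinates `y = rθ` on `ℝⁿ` the weight
`|y|^a` becomes `r^b` with `b = a + n - 1 ∈ (-1, 1)`, and along a fixed ray only the derivatives of
`φ` in `x` and in the direction `θ` are needed. A Fourier transform in `x` turns the energy on the
half-space `{(x, rθ) : r > 0}` into an integral over `ξ` of the one-dimensional energies
`∫₀^∞ r^b (λ² |w|² + |w'|²) dr`, where `λ = 2π|ξ|` and `w(r)` is the transform at `ξ` of
`x ↦ φ(x, rθ)` (`lintegral_sq_mul_enorm_sq_fourier`, `fourier_slice_zero`).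

For a fixed `ξ`, `w(0) = w(r) - ∫₀^r w'`, and the Cauchy-Schwarz inequality bounds the integral by
`(r^{1-b} / (1-b))^{1/2}` times the square root of `∫ t^b |w'|²`; this is where `b < 1` enters.
Squaring and integrating against `r^b dr` over `(0, 1/λ)`, which is possible as `b > -1`, gives
`λ^{1-b} |w(0)|² ≤ K ∫₀^∞ r^b (λ² |w|² + |w'|²) dr` (`rpow_mul_enorm_sq_le`). Since `1 - b = 2s`,
the integral over `ξ` of the left-hand side is `‖φ|_{Σ₀}‖²` in `𝒟ˢ` by Plancherel's theorem
(`ofReal_fracNorm_sq`). Averaging over the directions `θ` gives the trace inequality, with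
`C² = |S^{n-1}| / K`, which does not depend on the dimension of the `x`-space
(`exists_mul_fracNorm_restr_le`). The estimates are carried out for integrals with values in
`[0, ∞]`, so that they need no finiteness of the energies along single rays or at single `ξ`.

The trace operator is the extension by density of the restriction to the completions
(`exists_trace`), and density also gives its uniqueness.
-/

namespace WeightedTrace
open Set ENNReal

noncomputable section

/-! ### A weighted trace inequality on the half-line -/

theorem add_sq_le_two_mul_sq_add (x y : ℝ≥0∞) : (x + y) ^ 2 ≤ 2 * x ^ 2 + 2 * y ^ 2 := by
  have h := ENNReal.rpow_add_le_mul_rpow_add_rpow x y (p := 2) (by norm_num)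
  norm_num at h
  simpa [mul_add] using h

theorem lintegral_rpow_Ioc {p r : ℝ} (hp : -1 < p) (hr : 0 < r) :
    ∫⁻ t in Ioc 0 r, .ofReal (t ^ p) = .ofReal (r ^ (p + 1) / (p + 1)) := by
  have h := integral_rpow (a := 0) (b := r) (r := p) (Or.inl hp)
  rw [Real.zero_rpow (by linarith), sub_zero] at h
  rw [← h, intervalIntegral.integral_of_le hr.le, ofReal_integral_eq_lintegral_ofReal]
  · exact (intervalIntegral.intervalIntegrable_rpow' hp).1
  · filter_upwards [ae_restrict_mem measurableSet_Ioc] with t ht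
    exact Real.rpow_nonneg ht.1.le p

/-- The Cauchy-Schwarz inequality for `|g| = t^{-b/2} · t^{b/2} |g|` on `(0, r)`. -/
theorem sq_lintegral_enorm_Ioc_le {b r : ℝ} (hb : b < 1) (hr : 0 < r) {g : ℝ → ℂ}
    (hg : Measurable g) :
    (∫⁻ t in Ioc 0 r, ‖g t‖ₑ) ^ 2 ≤ .ofReal (r ^ (1 - b) / (1 - b)) *
      ∫⁻ t in Ioi 0, .ofReal (t ^ b) * ‖g t‖ₑ ^ 2 := by
  have hCS := ENNReal.lintegral_mul_le_Lp_mul_Lq (volume.restrict (Ioc 0 r))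
    Real.HolderConjugate.two_two
    (f := fun t => .ofReal (t ^ (-b / 2))) (g := fun t => .ofReal (t ^ (b / 2)) * ‖g t‖ₑ)
    (by fun_prop) (by fun_prop)
  have e₀ : ∫⁻ t in Ioc 0 r, ‖g t‖ₑ = ∫⁻ t in Ioc 0 r,
      ((fun t : ℝ => ENNReal.ofReal (t ^ (-b / 2))) *
        fun t : ℝ => ENNReal.ofReal (t ^ (b / 2)) * ‖g t‖ₑ) t := by
    refine setLIntegral_congr_fun measurableSet_Ioc fun t ht => ?_
    simp only [Pi.mul_apply]
    rw [← mul_assoc, ← ENNReal.ofReal_mul (Real.rpow_nonneg ht.1.le _), ← Real.rpow_add ht.1,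
      show -b / 2 + b / 2 = 0 by ring]
    simp
  have e₁ : ∫⁻ t in Ioc 0 r, ENNReal.ofReal (t ^ (-b / 2)) ^ (2 : ℝ) =
      .ofReal (r ^ (1 - b) / (1 - b)) := by
    rw [show 1 - b = -b + 1 by ring, ← lintegral_rpow_Ioc (by linarith) hr]
    refine setLIntegral_congr_fun measurableSet_Ioc fun t ht => ?_
    rw [ENNReal.ofReal_rpow_of_nonneg (Real.rpow_nonneg ht.1.le _) (by norm_num),
      ← Real.rpow_mul ht.1.le]
    congr 2; ring
  have e₂ : ∫⁻ t in Ioc 0 r, (ENNReal.ofReal (t ^ (b / 2)) * ‖g t‖ₑ) ^ (2 : ℝ) =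
      ∫⁻ t in Ioc 0 r, .ofReal (t ^ b) * ‖g t‖ₑ ^ 2 := by
    refine setLIntegral_congr_fun measurableSet_Ioc fun t ht => ?_
    rw [ENNReal.mul_rpow_of_nonneg _ _ (by norm_num),
      ENNReal.ofReal_rpow_of_nonneg (Real.rpow_nonneg ht.1.le _) (by norm_num),
      ← Real.rpow_mul ht.1.le, ENNReal.rpow_two]
    congr 3; ring
  have hsq : ∀ x : ℝ≥0∞, (x ^ ((1 : ℝ) / 2)) ^ 2 = x := fun x => by
    rw [← ENNReal.rpow_natCast, ← ENNReal.rpow_mul]; norm_num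
  rw [← e₀, e₁, e₂] at hCS
  calc _ ≤ _ := pow_le_pow_left₀ zero_le hCS 2
    _ = _ := by rw [mul_pow, hsq, hsq]
    _ ≤ _ := by gcongr; exact Ioc_subset_Ioi_self

/-- A constant `K` for the one-dimensional inequality
`λ^{1-b} |w(0)|² ≤ K ∫₀^∞ r^b (λ² |w|² + |w'|²) dr`, `-1 < b < 1` (not the optimal one). -/
def traceConst (b : ℝ) : ℝ := (1 + b) * (2 + 1 / (1 - b))

/-- The trace inequality on the half-line. The derivative enters only through the formula
`w(0) = w(r) - ∫₀^r g`, with `c` in the role of `w(0)` and `g` in that of `w'`. -/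
theorem rpow_mul_enorm_sq_le {b l : ℝ} (hb₁ : -1 < b) (hb₂ : b < 1) (hl : 0 ≤ l) {c : ℂ}
    {w g : ℝ → ℂ} (hw : Measurable w) (hg : Measurable g)
    (h : ∀ r, 0 < r → c = w r - ∫ t in Ioc 0 r, g t) :
    .ofReal (l ^ (1 - b)) * ‖c‖ₑ ^ 2 ≤ .ofReal (traceConst b) *
      ∫⁻ r in Ioi 0, .ofReal (r ^ b) * (.ofReal (l ^ 2) * ‖w r‖ₑ ^ 2 + ‖g r‖ₑ ^ 2) := by
  rcases hl.eq_or_lt with rfl | hl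
  -- At `l = 0` the left-hand side vanishes, the exponent `1 - b` being nonzero.
  · rw [Real.zero_rpow (by linarith)]; simp
  set W := ∫⁻ r in Ioi 0, .ofReal (r ^ b) * ‖w r‖ₑ ^ 2 with hW
  set G := ∫⁻ r in Ioi 0, .ofReal (r ^ b) * ‖g r‖ₑ ^ 2 with hG
  have hA : ∀ r, 0 < r → ‖c‖ₑ ^ 2 ≤ 2 * ‖w r‖ₑ ^ 2 +
      2 * (.ofReal (r ^ (1 - b) / (1 - b)) * G) := fun r hr => by
    refine le_trans ?_ ((add_sq_le_two_mul_sq_add ‖w r‖ₑ (∫⁻ t in Ioc 0 r, ‖g t‖ₑ)).trans ?_)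
    · gcongr
      rw [h r hr]
      exact enorm_sub_le.trans (by gcongr; exact enorm_integral_le_lintegral_enorm _)
    · gcongr
      exact sq_lintegral_enorm_Ioc_le hb₂ hr hg
  -- The length `1 / l` of the interval of integration is the one that balances the two terms.
  have hR : 0 < l⁻¹ := by positivity
  have hB : .ofReal (l⁻¹ ^ (b + 1) / (b + 1)) * ‖c‖ₑ ^ 2 ≤
      2 * W + .ofReal (l⁻¹ ^ 2 / (1 - b)) * G := by
    rw [← lintegral_rpow_Ioc hb₁ hR, ← lintegral_mul_const _ (by fun_prop)]
    calc ∫⁻ t in Ioc 0 l⁻¹, .ofReal (t ^ b) * ‖c‖ₑ ^ 2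
        ≤ ∫⁻ t in Ioc 0 l⁻¹, (2 * (.ofReal (t ^ b) * ‖w t‖ₑ ^ 2) +
            .ofReal (t ^ (1 : ℝ)) * (.ofReal (2 / (1 - b)) * G)) := by
          refine setLIntegral_mono (by fun_prop) fun t ht => ?_
          refine (mul_le_mul_right (hA t ht.1) _).trans_eq ?_
          rw [mul_add, mul_left_comm _ 2]
          congr 1
          have ht' : t ^ b * (2 * (t ^ (1 - b) / (1 - b))) = t ^ (1 : ℝ) * (2 / (1 - b)) := by
            rw [show (1 : ℝ) = b + (1 - b) by ring, Real.rpow_add ht.1,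
              show b + (1 - b) - b = 1 - b by ring]
            ring
          have hrw (x y z : ℝ≥0∞) : x * (2 * (y * z)) = x * (2 * y) * z := by ring
          rw [hrw, ← ENNReal.ofReal_ofNat 2, ← ENNReal.ofReal_mul (by norm_num),
            ← ENNReal.ofReal_mul (Real.rpow_nonneg ht.1.le b), ht',
            ENNReal.ofReal_mul (Real.rpow_nonneg ht.1.le 1), mul_assoc]
      _ ≤ _ := by
          rw [lintegral_add_left (by fun_prop), lintegral_const_mul _ (by fun_prop),
            lintegral_mul_const _ (by fun_prop), lintegral_rpow_Ioc (by norm_num) hR, ← mul_assoc,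
            ← ENNReal.ofReal_mul (by positivity)]
          gcongr
          · exact lintegral_mono_set Ioc_subset_Ioi_self
          · rw [show (1 : ℝ) + 1 = (2 : ℕ) by norm_num, Real.rpow_natCast]
            apply le_of_eq; field_simp; norm_num
  have hsum : ∫⁻ r in Ioi 0, .ofReal (r ^ b) * (.ofReal (l ^ 2) * ‖w r‖ₑ ^ 2 + ‖g r‖ₑ ^ 2) =
      .ofReal (l ^ 2) * W + G := by
    rw [hW, ← lintegral_const_mul _ (by fun_prop), hG, ← lintegral_add_left (by fun_prop)]
    congr 1; ext r; ring
  have hb' : 0 < 1 - b := by linarith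
  have hb'' : 0 < 1 + b := by linarith
  rw [hsum]
  calc _ = .ofReal (l ^ 2 * (1 + b)) *
        (.ofReal (l⁻¹ ^ (b + 1) / (b + 1)) * ‖c‖ₑ ^ 2) := by
        rw [← mul_assoc, ← ENNReal.ofReal_mul (by positivity)]
        congr 2
        rw [Real.inv_rpow hl.le, ← Real.rpow_neg hl.le, add_comm 1 b, mul_assoc,
          mul_div_cancel₀ _ (by linarith), ← Real.rpow_natCast, ← Real.rpow_add hl]
        congr 1; push_cast; ring
    _ ≤ .ofReal (l ^ 2 * (1 + b)) * (2 * W + .ofReal (l⁻¹ ^ 2 / (1 - b)) * G) := by gcongr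
    _ = .ofReal ((1 + b) * 2) * (.ofReal (l ^ 2) * W) + .ofReal ((1 + b) * (1 / (1 - b))) * G := by
        rw [mul_add, ← mul_assoc, ← mul_assoc, ← mul_assoc, ← ENNReal.ofReal_mul (by positivity),
          ← ENNReal.ofReal_mul (by positivity), ← ENNReal.ofReal_ofNat 2,
          ← ENNReal.ofReal_mul (by positivity)]
        congr 3
        · ring
        · field_simp
    _ ≤ _ := by
        rw [mul_add, traceConst]
        gcongr
        · have : 0 < 1 / (1 - b) := by positivity
          linarith
        · linarith

/-! ### Polar coordinates -/

theorem lintegral_eq_lintegral_sphere {E : Type*} [NormedAddCommGroup E] [NormedSpace ℝ E]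
    [MeasurableSpace E] [BorelSpace E] [FiniteDimensional ℝ E] [Nontrivial E] (μ : Measure E)
    [μ.IsAddHaarMeasure] {f : E → ℝ≥0∞} (hf : Measurable f) :
    ∫⁻ y, f y ∂μ = ∫⁻ θ : Metric.sphere (0 : E) 1,
      (∫⁻ r in Ioi (0 : ℝ), .ofReal (r ^ (Module.finrank ℝ E - 1)) * f (r • (θ : E)))
        ∂μ.toSphere := by
  have hm : Measurable fun p : Metric.sphere (0 : E) 1 × Ioi (0 : ℝ) => f (p.2.1 • p.1.1) :=
    hf.comp (by fun_prop)
  calc ∫⁻ y, f y ∂μ = ∫⁻ y in ({0}ᶜ : Set E), f y ∂μ := by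
        rw [restrict_compl_singleton]
    _ = ∫⁻ y : ({0}ᶜ : Set E), f y ∂(μ.comap (↑)) :=
        (lintegral_subtype_comap (measurableSet_singleton (0 : E)).compl f).symm
    _ = ∫⁻ p, f (p.2.1 • p.1.1)
          ∂(μ.toSphere.prod (Measure.volumeIoiPow (Module.finrank ℝ E - 1))) := by
        rw [← (μ.measurePreserving_homeomorphUnitSphereProd).lintegral_comp hm]
        refine lintegral_congr fun y => ?_
        rw [← homeomorphUnitSphereProd_symm_apply_coe, Homeomorph.symm_apply_apply]
    _ = _ := by
        rw [lintegral_prod _ hm.aemeasurable]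
        refine lintegral_congr fun θ => ?_
        have hm' : Measurable fun r : Ioi (0 : ℝ) => f (r.1 • (θ : E)) := hf.comp (by fun_prop)
        rw [Measure.volumeIoiPow, lintegral_withDensity_eq_lintegral_mul _ (by fun_prop) hm',
          ← lintegral_subtype_comap measurableSet_Ioi]
        rfl

/-! ### Slices and directional derivatives of test functions -/

/-- The slice `x ↦ φ (x, y)` of a test function, as a test function. -/
def slice {m n : ℕ} (φ : Cc (Rsp m × Rsp n)) (y : Rsp n) : Cc (Rsp m) where
  toFun x := φ (x, y)
  contDiff' := φ.contDiff.comp (contDiff_id.prodMk contDiff_const)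
  hasCompactSupport' :=
    φ.hasCompactSupport.comp_isClosedEmbedding (g := fun x : Rsp m => (x, y))
      ⟨isEmbedding_prodMkLeft y, by
        have : range (fun x : Rsp m => (x, y)) = Prod.snd ⁻¹' {y} := by ext ⟨_, _⟩; simp [eq_comm]
        rw [this]
        exact isClosed_singleton.preimage continuous_snd⟩
  tsupport_subset' := fun _ _ => trivial

@[simp]
theorem slice_apply {m n : ℕ} (φ : Cc (Rsp m × Rsp n)) (y : Rsp n) (x : Rsp m) :
    slice φ y x = φ (x, y) := rfl

theorem slice_zero {m n : ℕ} (φ : Cc (Rsp m × Rsp n)) : slice φ 0 = restr φ := rfl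

/-- The derivative of a test function in the direction `(0, v)`, as a test function. -/
def partialDeriv {m n : ℕ} (φ : Cc (Rsp m × Rsp n)) (v : Rsp n) : Cc (Rsp m × Rsp n) where
  toFun z := fderiv ℝ φ z (0, v)
  contDiff' := (φ.contDiff.fderiv_right (m := ∞) (by simp)).clm_apply contDiff_const
  hasCompactSupport' := φ.hasCompactSupport.fderiv_apply ℝ _
  tsupport_subset' := fun _ _ => trivial

@[simp]
theorem partialDeriv_apply {m n : ℕ} (φ : Cc (Rsp m × Rsp n)) (v : Rsp n) (z : Rsp m × Rsp n) :
    partialDeriv φ v z = fderiv ℝ φ z (0, v) := rfl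

/-! ### Plancherel identities -/

/-- Plancherel's theorem, as an identity in `[0, ∞]`. -/
theorem lintegral_enorm_sq_fourier {m : ℕ} (f : SchwartzMap (Rsp m) ℂ) :
    ∫⁻ ξ, ‖𝓕 f ξ‖ₑ ^ 2 = ∫⁻ x, ‖f x‖ₑ ^ 2 := by
  have h (g : SchwartzMap (Rsp m) ℂ) : ∫⁻ x, ‖g x‖ₑ ^ 2 = .ofReal (∫ x, ‖g x‖ ^ 2) := by
    rw [ofReal_integral_eq_lintegral_ofReal
      ((memLp_two_iff_integrable_sq_norm g.continuous.aestronglyMeasurable).1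
        (g.memLp 2 volume))
      (.of_forall fun x => by positivity)]
    refine lintegral_congr fun x => ?_
    rw [ENNReal.ofReal_pow (norm_nonneg _), ofReal_norm]
  rw [h, h, SchwartzMap.integral_norm_sq_fourier]

theorem lintegral_enorm_sq_fourier_Cc {m : ℕ} (u : Cc (Rsp m)) :
    ∫⁻ ξ, ‖𝓕 (fun x => (u x : ℂ)) ξ‖ₑ ^ 2 = ∫⁻ x, ‖u x‖ₑ ^ 2 := by
  rw [fourier_eq, lintegral_enorm_sq_fourier]
  refine lintegral_congr fun x => ?_
  rw [show toSchwartz u x = (u x : ℂ) from rfl, ← ofReal_norm, Complex.norm_real, ofReal_norm]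

/-- Plancherel's theorem for the gradient, from that for the partial derivatives. -/
theorem lintegral_sq_mul_enorm_sq_fourier {m : ℕ} (u : Cc (Rsp m)) :
    ∫⁻ ξ, .ofReal ((2 * Real.pi * ‖ξ‖) ^ 2) * ‖𝓕 (fun x => (u x : ℂ)) ξ‖ₑ ^ 2 =
      ∫⁻ x, ‖gradient u x‖ₑ ^ 2 := by
  set b := EuclideanSpace.basisFun (Fin m) ℝ
  have hsum (v : Rsp m) : ‖v‖ₑ ^ 2 = ∑ j, ‖inner ℝ v (b j)‖ₑ ^ 2 := by
    simp only [← ofReal_norm]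
    rw [← ENNReal.ofReal_pow (norm_nonneg _), ← b.sum_sq_norm_inner_left v,
      ENNReal.ofReal_sum_of_nonneg (fun _ _ => by positivity)]
    exact Finset.sum_congr rfl fun j _ => ENNReal.ofReal_pow (norm_nonneg _) 2
  have hd (j : Fin m) (x : Rsp m) :
      ‖LineDeriv.lineDerivOp (b j) (toSchwartz u) x‖ₑ = ‖inner ℝ (gradient u x) (b j)‖ₑ := by
    have h := (Complex.ofRealCLM.hasFDerivAt.comp x
      ((u.contDiff.differentiable (by simp)) x).hasFDerivAt).fderiv
    rw [SchwartzMap.lineDerivOp_apply_eq_fderiv,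
      show (toSchwartz u : Rsp m → ℂ) = Complex.ofRealCLM ∘ u from rfl, h, gradient,
      InnerProductSpace.toDual_symm_apply]
    simp [← ofReal_norm]
  have hF (j : Fin m) (ξ : Rsp m) : ‖𝓕 (LineDeriv.lineDerivOp (b j) (toSchwartz u)) ξ‖ₑ ^ 2 =
      .ofReal ((2 * Real.pi) ^ 2) * ‖inner ℝ ξ (b j)‖ₑ ^ 2 * ‖𝓕 (toSchwartz u) ξ‖ₑ ^ 2 := by
    have ht : Function.HasTemperateGrowth (inner ℝ · (b j)) :=
      ((innerSL ℝ).flip (b j)).hasTemperateGrowth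
    rw [SchwartzMap.fourier_lineDerivOp_eq, smul_apply,
      SchwartzMap.smulLeftCLM_apply_apply ht, enorm_smul, enorm_smul, mul_pow, mul_pow,
      mul_assoc (ENNReal.ofReal _)]
    congr 1
    rw [ENNReal.ofReal_pow (by positivity), ← ofReal_norm]
    simp [abs_of_pos Real.pi_pos]
  calc _ = ∫⁻ ξ, ∑ j, ‖𝓕 (LineDeriv.lineDerivOp (b j) (toSchwartz u)) ξ‖ₑ ^ 2 := by
        refine lintegral_congr fun ξ => ?_
        rw [fourier_eq, mul_pow, ENNReal.ofReal_mul (by positivity),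
          ENNReal.ofReal_pow (norm_nonneg ξ), ofReal_norm, hsum, Finset.mul_sum, Finset.sum_mul]
        exact Finset.sum_congr rfl fun j _ => (hF j ξ).symm
    _ = ∫⁻ x, ∑ j, ‖LineDeriv.lineDerivOp (b j) (toSchwartz u) x‖ₑ ^ 2 := by
        rw [lintegral_finsetSum' _ fun j _ => by fun_prop,
          lintegral_finsetSum' _ fun j _ => by fun_prop]
        exact Finset.sum_congr rfl fun j _ => lintegral_enorm_sq_fourier _
    _ = _ := by
        refine lintegral_congr fun x => ?_
        rw [hsum]
        exact Finset.sum_congr rfl fun j _ => by rw [hd]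

/-! ### The Fourier transform of the slices along a ray -/

/-- The partial Fourier transform in `x` of the fundamental theorem of calculus along the ray
`t ↦ t v`. -/
theorem fourier_slice_zero {m n : ℕ} (φ : Cc (Rsp m × Rsp n)) {v : Rsp n} (hv : v ≠ 0) {r : ℝ}
    (hr : 0 < r) (ξ : Rsp m) :
    𝓕 (fun x => (slice φ 0 x : ℂ)) ξ = 𝓕 (fun x => (slice φ (r • v) x : ℂ)) ξ -
      ∫ t in Ioc 0 r, 𝓕 (fun x => (slice (partialDeriv φ v) (t • v) x : ℂ)) ξ := by
  set χ := partialDeriv φ v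
  have hemb : Topology.IsClosedEmbedding fun p : Rsp m × ℝ => (p.1, p.2 • v) :=
    Topology.IsClosedEmbedding.id.prodMap (isClosedEmbedding_smul_left hv)
  have hsupp : HasCompactSupport (fun p : Rsp m × ℝ => χ (p.1, p.2 • v)) :=
    χ.hasCompactSupport.comp_isClosedEmbedding hemb
  have hcont : Continuous (fun p : Rsp m × ℝ => χ (p.1, p.2 • v)) :=
    χ.contDiff.continuous.comp (by fun_prop)
  have hFTC (x : Rsp m) : (φ (x, 0) : ℂ) =
      φ (x, r • v) - ∫ t in Ioc 0 r, (χ (x, t • v) : ℂ) := by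
    have hder (t : ℝ) : HasDerivAt (fun t : ℝ => φ (x, t • v)) (χ (x, t • v)) t := by
      have h₁ : HasDerivAt (fun t : ℝ => (x, t • v)) ((0 : Rsp m), v) t := by
        have := (hasDerivAt_const t x).prodMk ((hasDerivAt_id t).smul_const v)
        simpa using this
      exact ((φ.contDiff.differentiable (by simp)) _).hasFDerivAt.comp_hasDerivAt t h₁
    have h := intervalIntegral.integral_eq_sub_of_hasDerivAt (a := 0) (b := r)
      (fun t _ => hder t)
      ((hcont.comp (Continuous.prodMk_right x)).intervalIntegrable 0 r)
    rw [intervalIntegral.integral_of_le hr.le] at h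
    rw [integral_complex_ofReal, h]
    simp
  have hint : Integrable
      (Function.uncurry fun x t => Real.fourierChar (-inner ℝ x ξ) • (χ (x, t • v) : ℂ))
      ((volume : Measure (Rsp m)).prod (volume.restrict (Ioc 0 r))) := by
    refine Continuous.integrable_of_hasCompactSupport ?_ (hsupp.mono fun p hp hp' => hp ?_)
    · exact (Real.continuous_fourierChar.comp (by fun_prop)).smul
        (Complex.continuous_ofReal.comp hcont)
    · simp only at hp'
      simp [Function.uncurry, hp']
  simp only [Real.fourier_eq, slice_apply]
  rw [← integral_integral_swap hint, ← integral_sub]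
  · refine integral_congr_ae (.of_forall fun x => ?_)
    simp only
    rw [hFTC, smul_sub]
    simp only [Circle.smul_def, smul_eq_mul, integral_const_mul]
  · refine Continuous.integrable_of_hasCompactSupport ?_
      ((slice φ (r • v)).hasCompactSupport.mono fun p hp hp' => hp ?_)
    · exact (Real.continuous_fourierChar.comp (by fun_prop)).smul
        (Complex.continuous_ofReal.comp (slice φ (r • v)).contDiff.continuous)
    · simp only [slice_apply] at hp'
      simp [hp']
  · exact hint.integral_prod_left

theorem measurable_fourier_slice {m n : ℕ} (φ : Cc (Rsp m × Rsp n)) (v : Rsp n) :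
    Measurable fun p : Rsp m × ℝ => 𝓕 (fun x => (slice φ (p.2 • v) x : ℂ)) p.1 := by
  have hcont : Continuous (Function.uncurry fun (p : Rsp m × ℝ) (x : Rsp m) =>
      Real.fourierChar (-inner ℝ x p.1) • (φ (x, p.2 • v) : ℂ)) := by
    refine (Real.continuous_fourierChar.comp ?_).smul
      (Complex.continuous_ofReal.comp (φ.contDiff.continuous.comp ?_))
    · fun_prop
    · fun_prop
  simp only [Real.fourier_eq, slice_apply]
  exact (hcont.stronglyMeasurable.integral_prod_right' (ν := volume)).measurable

/-! ### The trace inequality, ray by ray and averaged -/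

theorem enorm_sq_grad {m n : ℕ} (φ : Rsp m × Rsp n → ℝ) (z : Rsp m × Rsp n) :
    ‖grad φ z‖ₑ ^ 2 = ‖gradient (fun x => φ (x, z.2)) z.1‖ₑ ^ 2 +
      ‖gradient (fun y => φ (z.1, y)) z.2‖ₑ ^ 2 := by
  simp only [← ofReal_norm]
  simp only [← ENNReal.ofReal_pow (norm_nonneg _)]
  rw [← ENNReal.ofReal_add (by positivity) (by positivity), WithLp.prod_norm_sq_eq_of_L2]
  rfl

theorem enorm_partialDeriv_le {m n : ℕ} (φ : Cc (Rsp m × Rsp n)) {v : Rsp n} (hv : ‖v‖ = 1)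
    (z : Rsp m × Rsp n) :
    ‖partialDeriv φ v z‖ₑ ≤ ‖gradient (fun y => φ (z.1, y)) z.2‖ₑ := by
  have h := (HasFDerivAt.comp z.2 (g := φ) (f := fun y => (z.1, y))
    ((φ.contDiff.differentiable (by simp)) z).hasFDerivAt
    (hasFDerivAt_prodMk_right z.1 z.2)).fderiv
  have e : partialDeriv φ v z = inner ℝ (gradient (fun y => φ (z.1, y)) z.2) v := by
    rw [gradient, InnerProductSpace.toDual_symm_apply]
    change _ = fderiv ℝ (φ ∘ fun y => (z.1, y)) z.2 v
    rw [h]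
    simp
  rw [e, enorm_le_iff_norm_le]
  simpa [hv] using norm_inner_le_norm (𝕜 := ℝ) (gradient (fun y => φ (z.1, y)) z.2) v

/-- The trace inequality on the half-space `{(x, r v) : r > 0}`. -/
theorem lintegral_fourier_restr_le_ray {m n : ℕ} {b : ℝ} (hb₁ : -1 < b) (hb₂ : b < 1)
    (φ : Cc (Rsp m × Rsp n)) {v : Rsp n} (hv : ‖v‖ = 1) :
    ∫⁻ ξ, .ofReal ((2 * Real.pi * ‖ξ‖) ^ (1 - b)) * ‖𝓕 (fun x => (restr φ x : ℂ)) ξ‖ₑ ^ 2 ≤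
      .ofReal (traceConst b) *
        ∫⁻ r in Ioi 0, .ofReal (r ^ b) * ∫⁻ x, ‖grad φ (x, r • v)‖ₑ ^ 2 := by
  have hv₀ : v ≠ 0 := by rintro rfl; simp at hv
  -- `w` and `g` are kept opaque, so that unification does not unfold the Fourier integrals.
  obtain ⟨w, hw⟩ : ∃ w : Rsp m → ℝ → ℂ, ∀ ξ r, w ξ r = 𝓕 (fun x => (slice φ (r • v) x : ℂ)) ξ :=
    ⟨_, fun _ _ => rfl⟩
  obtain ⟨g, hg⟩ : ∃ g : Rsp m → ℝ → ℂ, ∀ ξ r,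
      g ξ r = 𝓕 (fun x => (slice (partialDeriv φ v) (r • v) x : ℂ)) ξ := ⟨_, fun _ _ => rfl⟩
  have hwm : Measurable (Function.uncurry w) := by
    simpa only [Function.uncurry_def, hw] using measurable_fourier_slice φ v
  have hgm : Measurable (Function.uncurry g) := by
    simpa only [Function.uncurry_def, hg] using measurable_fourier_slice (partialDeriv φ v) v
  have h₀ (ξ : Rsp m) (r : ℝ) (hr : 0 < r) :
      𝓕 (fun x => (restr φ x : ℂ)) ξ = w ξ r - ∫ t in Ioc 0 r, g ξ t := by
    simp only [hw, hg, ← slice_zero]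
    exact fourier_slice_zero φ hv₀ hr ξ
  have hPw (r : ℝ) : ∫⁻ ξ, .ofReal ((2 * Real.pi * ‖ξ‖) ^ 2) * ‖w ξ r‖ₑ ^ 2 =
      ∫⁻ x, ‖gradient (slice φ (r • v)) x‖ₑ ^ 2 := by
    simp only [hw]; exact lintegral_sq_mul_enorm_sq_fourier _
  have hPg (r : ℝ) : ∫⁻ ξ, ‖g ξ r‖ₑ ^ 2 = ∫⁻ x, ‖slice (partialDeriv φ v) (r • v) x‖ₑ ^ 2 := by
    simp only [hg]; exact lintegral_enorm_sq_fourier_Cc _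
  calc _ ≤ ∫⁻ ξ, .ofReal (traceConst b) * ∫⁻ r in Ioi 0, .ofReal (r ^ b) *
          (.ofReal ((2 * Real.pi * ‖ξ‖) ^ 2) * ‖w ξ r‖ₑ ^ 2 + ‖g ξ r‖ₑ ^ 2) :=
        lintegral_mono fun ξ => rpow_mul_enorm_sq_le hb₁ hb₂ (by positivity)
          hwm.of_uncurry_left hgm.of_uncurry_left (h₀ ξ)
    _ = .ofReal (traceConst b) * ∫⁻ ξ, ∫⁻ r in Ioi 0, .ofReal (r ^ b) *
          (.ofReal ((2 * Real.pi * ‖ξ‖) ^ 2) * ‖w ξ r‖ₑ ^ 2 + ‖g ξ r‖ₑ ^ 2) :=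
        lintegral_const_mul' _ _ ofReal_ne_top
    _ = .ofReal (traceConst b) * ∫⁻ r in Ioi 0, ∫⁻ ξ, .ofReal (r ^ b) *
          (.ofReal ((2 * Real.pi * ‖ξ‖) ^ 2) * ‖w ξ r‖ₑ ^ 2 + ‖g ξ r‖ₑ ^ 2) := by
        rw [lintegral_lintegral_swap]
        refine Measurable.aemeasurable (Measurable.mul ?_ (Measurable.add (Measurable.mul ?_
          (hwm.enorm.pow_const 2)) (hgm.enorm.pow_const 2))) <;> fun_prop
    _ ≤ _ := by
        refine mul_le_mul_right (lintegral_mono fun r => ?_) _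
        rw [lintegral_const_mul' _ _ ofReal_ne_top]
        refine mul_le_mul_right ?_ _
        have hg' : Measurable fun ξ => ‖g ξ r‖ₑ ^ 2 :=
          hgm.of_uncurry_right.enorm.pow_const 2
        rw [lintegral_add_right _ hg', hPw, hPg]
        have hχ : Continuous (slice (partialDeriv φ v) (r • v)) :=
          (slice (partialDeriv φ v) (r • v)).contDiff.continuous
        rw [← lintegral_add_right _ (by fun_prop)]
        refine lintegral_mono fun x => ?_
        rw [enorm_sq_grad]
        gcongr
        · exact le_rfl
        · exact enorm_partialDeriv_le φ hv (x, r • v)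

/-- The average of the trace inequalities on the half-spaces over all directions. -/
theorem toSphere_mul_lintegral_fourier_restr_le {m n : ℕ} (hn : 0 < n) {a : ℝ} (ha₀ : 0 < a + n)
    (ha₂ : a + n < 2) (φ : Cc (Rsp m × Rsp n)) :
    (volume : Measure (Rsp n)).toSphere univ *
      ∫⁻ ξ, .ofReal ((2 * Real.pi * ‖ξ‖) ^ (2 - a - n)) * ‖𝓕 (fun x => (restr φ x : ℂ)) ξ‖ₑ ^ 2 ≤
      .ofReal (traceConst (a + n - 1)) * ∫⁻ z, .ofReal (‖z.2‖ ^ a) * ‖grad φ z‖ₑ ^ 2 := by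
  have : Nonempty (Fin n) := ⟨⟨0, hn⟩⟩
  have hgrad : Continuous (grad φ) := continuous_grad φ
  have hf : Measurable fun z : Rsp m × Rsp n => ENNReal.ofReal (‖z.2‖ ^ a) * ‖grad φ z‖ₑ ^ 2 := by
    fun_prop
  have hray (θ : Metric.sphere (0 : Rsp n) 1) := lintegral_fourier_restr_le_ray
    (b := a + n - 1) (by linarith) (by linarith) φ (v := θ) (by simp)
  rw [show 1 - (a + n - 1) = 2 - a - n by ring] at hray
  rw [mul_comm, ← lintegral_const]
  refine (lintegral_mono hray).trans_eq ?_
  rw [lintegral_const_mul' _ _ ofReal_ne_top, Measure.volume_eq_prod, lintegral_prod_symm' _ hf,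
    lintegral_eq_lintegral_sphere volume hf.lintegral_prod_left']
  congr 1
  refine lintegral_congr fun θ => setLIntegral_congr_fun measurableSet_Ioi fun r hr => ?_
  have hr : 0 < r := hr
  have hθ : ‖(θ : Rsp n)‖ = 1 := by simp
  simp only [finrank_euclideanSpace, Fintype.card_fin, norm_smul, hθ, mul_one,
    Real.norm_of_nonneg hr.le]
  rw [lintegral_const_mul' _ _ ofReal_ne_top, ← mul_assoc, ← ENNReal.ofReal_mul (by positivity)]
  congr 2
  rw [← Real.rpow_natCast, ← Real.rpow_add hr, Nat.cast_sub (by omega)]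
  congr 1; push_cast; ring

/-! ### The two norms as integrals with values in `[0, ∞]` -/

theorem ofReal_dirichletNorm_sq {m n : ℕ} {a : ℝ} (ha : 0 < a + n) (φ : Cc (Rsp m × Rsp n)) :
    .ofReal (dirichletNorm a φ ^ 2) = ∫⁻ z, .ofReal (‖z.2‖ ^ a) * ‖grad φ z‖ₑ ^ 2 := by
  have h := memLp_weighted_grad ha φ
  rw [dirichletNorm_eq, Real.sq_sqrt (integral_nonneg fun _ => by positivity),
    ofReal_integral_eq_lintegral_ofReal ((memLp_two_iff_integrable_sq_norm h.1).1 h)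
      (.of_forall fun _ => by positivity)]
  refine lintegral_congr fun z => ?_
  rw [norm_smul, mul_pow, ENNReal.ofReal_mul (by positivity), ENNReal.ofReal_pow (norm_nonneg _),
    ENNReal.ofReal_pow (norm_nonneg _), ofReal_norm, ofReal_norm,
    Real.enorm_of_nonneg (by positivity), ← ENNReal.ofReal_pow (by positivity),
    ← Real.rpow_mul_natCast (norm_nonneg _)]
  norm_num

theorem ofReal_fracNorm_sq {m : ℕ} {s : ℝ} (hs : 0 ≤ s) (u : Cc (Rsp m)) :
    .ofReal (fracNorm s u ^ 2) =
      ∫⁻ ξ, .ofReal ((2 * Real.pi * ‖ξ‖) ^ (2 * s)) * ‖𝓕 (fun x => (u x : ℂ)) ξ‖ₑ ^ 2 := by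
  have hs' : 0 ≤ s / 2 := by positivity
  have h1 := integrable_fracSymbolMul hs' u
  have h2 := memLp_fracSymbolMul hs' u
  have hP : fracNorm s u = (eLpNorm (fracSymbolMul (s / 2) u) 2 volume).toReal := by
    rw [fracNorm, sqrt_integral_eq (memLp_fracLaplacian hs' u)]
    change (eLpNorm (𝓕⁻ (fracSymbolMul (s / 2) u)) 2 volume).toReal = _
    rw [← eLpNorm_congr_ae (fourierInv_toLp_ae_eq h1 h2), ← Lp.norm_def,
      ← Lp.norm_fourier_eq, FourierTransform.fourier_fourierInv_eq, Lp.norm_toLp]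
  rw [hP, ← sqrt_integral_eq h2, Real.sq_sqrt (integral_nonneg fun _ => by positivity),
    ofReal_integral_eq_lintegral_ofReal ((memLp_two_iff_integrable_sq_norm h2.1).1 h2)
      (.of_forall fun _ => by positivity)]
  refine lintegral_congr fun ξ => ?_
  rw [fracSymbolMul, norm_mul, mul_pow, ENNReal.ofReal_mul (by positivity),
    ENNReal.ofReal_pow (norm_nonneg (𝓕 (fun x => (u x : ℂ)) ξ)), ofReal_norm, Complex.norm_real,
    Real.norm_of_nonneg (by positivity), ← Real.rpow_mul_natCast (by positivity)]
  congr 3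
  push_cast; ring

/-! ### The trace inequality with a uniform constant -/

/-- The constant is chosen before the dimension `m` of the `x`-space. -/
theorem exists_mul_fracNorm_restr_le {n : ℕ} (hn : 0 < n) {a : ℝ} (ha₀ : 0 < a + n)
    (ha₂ : a + n < 2) :
    ∃ C : ℝ, 0 < C ∧ ∀ (m : ℕ) (φ : Cc (Rsp m × Rsp n)),
      C * fracNorm ((2 - a - n) / 2) (restr φ) ≤ dirichletNorm a φ := by
  have : Nonempty (Fin n) := ⟨⟨0, hn⟩⟩
  have hK : 0 < traceConst (a + n - 1) := by
    have h₁ : 0 < 1 + (a + n - 1) := by linarith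
    have h₂ : 0 < 1 - (a + n - 1) := by linarith
    unfold traceConst; positivity
  set σ := (volume : Measure (Rsp n)).toSphere.real univ with hσ
  have hσ₀ : 0 < σ := by
    rw [hσ, measureReal_def, ENNReal.toReal_pos_iff]
    exact ⟨Measure.measure_univ_pos.2 (Measure.toSphere_ne_zero _), measure_lt_top _ _⟩
  refine ⟨√(σ / traceConst (a + n - 1)), by positivity, fun m φ => ?_⟩
  have h := toSphere_mul_lintegral_fourier_restr_le hn ha₀ ha₂ φ
  have hF := ofReal_fracNorm_sq (s := (2 - a - n) / 2) (by linarith) (restr φ)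
  rw [mul_div_cancel₀ _ two_ne_zero] at hF
  rw [← hF, ← ofReal_dirichletNorm_sq ha₀, ← ofReal_measureReal (measure_ne_top _ _), ← hσ,
    ← ENNReal.ofReal_mul hσ₀.le, ← ENNReal.ofReal_mul hK.le,
    ENNReal.ofReal_le_ofReal_iff (by positivity)] at h
  refine le_of_sq_le_sq ?_ (Real.sqrt_nonneg _)
  rw [mul_pow, Real.sq_sqrt (by positivity), div_mul_eq_mul_div, div_le_iff₀' hK]
  exact h

/-! ### The trace operator -/

/-- The restriction `φ ↦ φ|_{Σ₀}` as a linear map between the test functions with their energy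
norms. -/
def restrLinear (m n : ℕ) {a : ℝ} (ha : 0 < a + n) {s : ℝ} (hs : 0 < s) :
    PreD1 m n a ha →ₗ[ℝ] PreDs m s hs where
  toFun φ := restr (m := m) (n := n) φ
  map_add' _ _ := rfl
  map_smul' _ _ := rfl

theorem denseRange_toD1 {m n : ℕ} {a : ℝ} (ha : 0 < a + n) :
    DenseRange (toD1 (m := m) ha) :=
  UniformSpace.Completion.denseRange_coe (α := PreD1 m n a ha)

/-- A trace inequality on test functions extends to the completions. -/
theorem exists_trace {m n : ℕ} {a s C : ℝ} (ha : 0 < a + n) (hs : 0 < s) (hC : 0 < C)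
    (h : ∀ φ : Cc (Rsp m × Rsp n), C * fracNorm s (restr φ) ≤ dirichletNorm a φ) :
    ∃ Tr : D1 m n a ha →L[ℝ] Ds m s hs,
      (∀ φ : Cc (Rsp m × Rsp n), Tr (toD1 ha φ) = toDs hs (restr φ)) ∧
      ∀ U : D1 m n a ha, C * ‖Tr U‖ ≤ ‖U‖ := by
  have hb (φ : PreD1 m n a ha) : ‖restrLinear m n ha hs φ‖ ≤ C⁻¹ * ‖φ‖ := by
    rw [inv_mul_eq_div, le_div_iff₀' hC]
    exact h φ
  set Tr := (UniformSpace.Completion.toComplL.comp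
    ((restrLinear m n ha hs).mkContinuous C⁻¹ hb)).extend
      (UniformSpace.Completion.toComplL (𝕜 := ℝ) (E := PreD1 m n a ha))
  have hTr' (φ : Cc (Rsp m × Rsp n)) : Tr (toD1 ha φ) = toDs hs (restr φ) :=
    ContinuousLinearMap.extend_eq _ UniformSpace.Completion.denseRange_coe
      (UniformSpace.Completion.isUniformInducing_coe _) (show PreD1 m n a ha from φ)
  refine ⟨Tr, hTr', fun U => ?_⟩
  refine (denseRange_toD1 ha).induction_on U
    (isClosed_le (by fun_prop) continuous_norm) fun φ => ?_
  rw [hTr', norm_toDs, norm_toD1]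
  exact h φ

end

end WeightedTrace

theorem lemma4p1 (n : ℕ) (hn : 2 ≤ n) (a : ℝ) (ha₀ : 0 < a + n) (ha₂ : a + n < 2)
    (s : ℝ) (hs : s = (2 - a - n) / 2) :
    ∃ hs₀ : 0 < s, s < 1 ∧ ∃ C : ℝ, 0 < C ∧ ∀ d : ℕ, n < d →
      (∀ φ : Cc (Rsp (d - n) × Rsp n), C * fracNorm s (restr φ) ≤ dirichletNorm a φ) ∧
      (2 < d + a ↔ 2 * s < (d : ℝ) - n) ∧
      (2 < d + a →
        ∃ Tr : D1 (d - n) n a ha₀ →L[ℝ] Ds (d - n) s hs₀,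
          (∀ φ : Cc (Rsp (d - n) × Rsp n), Tr (toD1 ha₀ φ) = toDs hs₀ (restr φ)) ∧
          (∀ U : D1 (d - n) n a ha₀, C * ‖Tr U‖ ≤ ‖U‖) ∧
          (∀ T : D1 (d - n) n a ha₀ → Ds (d - n) s hs₀, Continuous T →
            (∀ φ : Cc (Rsp (d - n) × Rsp n), T (toD1 ha₀ φ) = toDs hs₀ (restr φ)) →
            ∀ U : D1 (d - n) n a ha₀, T U = Tr U)) := by
  have hs₀ : 0 < s := by rw [hs]; linarith
  refine ⟨hs₀, by rw [hs]; linarith, ?_⟩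
  obtain ⟨C, hC, h⟩ := exists_mul_fracNorm_restr_le (by omega : 0 < n) ha₀ ha₂
  rw [← hs] at h
  refine ⟨C, hC, fun d _ => ⟨h (d - n), ⟨fun h => ?_, fun h => ?_⟩, fun _ => ?_⟩⟩
  · rw [hs]; linarith
  · rw [hs] at h; linarith
  · obtain ⟨Tr, hTr, hle⟩ := exists_trace ha₀ hs₀ hC (h (d - n))
    refine ⟨Tr, hTr, hle, fun T hT hTφ => congrFun ((denseRange_toD1 ha₀).equalizer hT
      Tr.continuous (funext fun φ => ?_))⟩
    exact (hTφ φ).trans (hTr φ).symm
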